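/- Let $\mathrm{Cu}_2$ be the involutive monoid with identity $e$ and zero element $\lozenge$ generated by $s_1,s_2,s_1^*,s_2^*$ subject to the relations $s_1^*s_1=e=s_2^*s_2$ and $s_1^*s_2=\lozenge=s_2^*s_1$. Let $\mathcal A=\ell^1(\mathrm{Cu}_2\setminus\{\lozenge\})$ be the unital Banach $*$-algebra over $\mathbb C$ whose product $\#$ is the continuous bilinear extension of $\delta_s\#\delta_t=\delta_{st}$ if $st\neq\lozenge$ and $\delta_s\#\delta_t=0$ if $st=\lozenge$, whose unit is $\delta_e$, and whose involution is $f^*(s)=\overline{f(s^*)}$. Let $\mathcal J$ be the closed two-sided ideal of $\mathcal A$ generated by $f_0=\delta_e-\delta_{s_1s_1^*}-\delta_{s_2s_2^*}$; it is a $*$-ideal. Then $\mathcal A/\mathcal J$, with the quotient norm and the induced product and involution, is an infinite-dimensional, purely infinite, unital Banach $*$-algebra. That is: it is complete in a submultiplicative norm with $\|1\|=1$ and has an isometric conjugate-linear involution with $(ab)^*=b^*a^*$; it is infinite-dimensional over $\mathbb C$; it is not a division algebra (equivalently, by Gelfand–Mazur, not isomorphic to $\mathbb C$); and for every nonzero $a\in\mathcal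 A/\mathcal J$ there exist $b,c\in\mathcal A/\mathcal J$ with $bac=1$. -/

import Mathlib

open scoped ENNReal

/-! ### The semigroup algebra `ℓ¹(S \ {◇})` of a monoid `S` with zero element `◇` -/

/-- The Banach space `ℓ¹(S \ {◇})` of absolutely summable complex functions on the nonzero
elements of `S`, with its `ℓ¹` norm. (A type synonym: product and involution are defined below and
are *not* the pointwise ones.) -/
def ReducedL1 (S : Type*) [MonoidWithZero S] : Type _ :=
  lp (fun _ : {s : S // s ≠ 0} => ℂ) 1

namespace ReducedL1

noncomputable section

section Space

variable {S : Type*} [MonoidWithZero S]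

instance : NormedAddCommGroup (ReducedL1 S) :=
  inferInstanceAs (NormedAddCommGroup (lp (fun _ : {s : S // s ≠ 0} => ℂ) 1))

instance : NormedSpace ℂ (ReducedL1 S) :=
  inferInstanceAs (NormedSpace ℂ (lp (fun _ : {s : S // s ≠ 0} => ℂ) 1))

instance : CompleteSpace (ReducedL1 S) :=
  inferInstanceAs (CompleteSpace (lp (fun _ : {s : S // s ≠ 0} => ℂ) 1))

/-- The value `f(s)` for `s ≠ ◇`. -/
def coeff (f : ReducedL1 S) (s : {s : S // s ≠ 0}) : ℂ := f.1 s

theorem ext_coeff {f g : ReducedL1 S} (h : ∀ s, f.coeff s = g.coeff s) : f = g :=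
  Subtype.ext (funext h)

theorem coeff_add (f g : ReducedL1 S) (s) : (f + g).coeff s = f.coeff s + g.coeff s := rfl

theorem coeff_smul (c : ℂ) (f : ReducedL1 S) (s) : (c • f).coeff s = c * f.coeff s := rfl

theorem hasSum_norm_coeff (f : ReducedL1 S) : HasSum (fun s => ‖f.coeff s‖) ‖f‖ := by
  have h := lp.hasSum_norm (p := 1) (by simp) (f : lp (fun _ : {s : S // s ≠ 0} => ℂ) 1)
  simp only [ENNReal.toReal_one, Real.rpow_one] at h
  exact h

open Classical in
/-- The point mass `δ_s`, with the convention `δ_◇ = 0`. -/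
def delta (s : S) : ReducedL1 S :=
  if h : s = 0 then 0 else lp.single (E := fun _ : {s : S // s ≠ 0} => ℂ) 1 ⟨s, h⟩ (1 : ℂ)

theorem delta_zero : delta (0 : S) = 0 := by simp [delta]

open Classical in
theorem delta_of_ne (s : {s : S // s ≠ 0}) :
    delta s.1 = (lp.single (E := fun _ : {s : S // s ≠ 0} => ℂ) 1 s (1 : ℂ) : ReducedL1 S) :=
  dif_neg s.2

open Classical in
theorem coeff_delta (s t : {s : S // s ≠ 0}) :
    (delta s.1).coeff t = if t = s then 1 else 0 := by
  rw [delta_of_ne]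
  change (lp.single (E := fun _ : {s : S // s ≠ 0} => ℂ) 1 s (1 : ℂ)) t = _
  rw [lp.single_apply]
  by_cases h : t = s
  · subst h; simp
  · simp [h]

theorem norm_delta_le (s : S) : ‖delta s‖ ≤ 1 := by
  classical
  by_cases h : s = 0
  · subst h; simp [delta_zero]
  · have h1 := delta_of_ne (⟨s, h⟩ : {s : S // s ≠ 0})
    have h2 := lp.norm_single (E := fun _ : {s : S // s ≠ 0} => ℂ) (p := 1) (by simp) ⟨s, h⟩ (1 : ℂ)
    simp only at h1
    rw [h1]
    refine le_trans (le_of_eq h2) ?_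
    simp

theorem hasSum_delta (f : ReducedL1 S) : HasSum (fun s => f.coeff s • delta s.1) f := by
  classical
  have h := lp.hasSum_single (p := 1) (by simp) (f : lp (fun _ : {s : S // s ≠ 0} => ℂ) 1)
  refine h.congr_fun ?_ |> fun h => h
  intro s
  rw [delta_of_ne]
  refine ext_coeff fun t => ?_
  change f.coeff s * (lp.single (E := fun _ : {s : S // s ≠ 0} => ℂ) 1 s (1 : ℂ)) t =
    (lp.single (E := fun _ : {s : S // s ≠ 0} => ℂ) 1 s (f.coeff s)) t
  simp only [lp.single_apply]
  by_cases h : t = s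
  · subst h; simp
  · simp [h]

/-- A closed additive property of elements of `ℓ¹` which holds for multiples of point masses holds
for all elements. -/
theorem induction_delta {P : ReducedL1 S → Prop} (hclosed : IsClosed {f | P f}) (h0 : P 0)
    (hadd : ∀ f g, P f → P g → P (f + g))
    (hdelta : ∀ (c : ℂ) (s : {s : S // s ≠ 0}), P (c • delta s.1)) (f : ReducedL1 S) : P f := by
  refine hclosed.mem_of_tendsto (hasSum_delta f) (Filter.Eventually.of_forall fun F => ?_)
  exact Finset.sum_induction _ P hadd h0 fun s _ => hdelta _ _

end Space

section Lift

variable {S : Type*} [MonoidWithZero S] {E : Type*} [NormedAddCommGroup E] [NormedSpace ℂ E]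
  [CompleteSpace E]

theorem summable_lift (v : {s : S // s ≠ 0} → E) (C : ℝ) (hv : ∀ s, ‖v s‖ ≤ C)
    (f : ReducedL1 S) : Summable fun s => f.coeff s • v s := by
  refine Summable.of_norm_bounded (f.hasSum_norm_coeff.summable.mul_right C) fun s => ?_
  rw [norm_smul]
  exact mul_le_mul_of_nonneg_left (hv s) (norm_nonneg _)

/-- The bounded linear map `ℓ¹(S \ {◇}) → E` sending `δ_s` to `v s`, for a bounded family `v`. -/
def lift (v : {s : S // s ≠ 0} → E) (C : ℝ) (hv : ∀ s, ‖v s‖ ≤ C) :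
    ReducedL1 S →L[ℂ] E :=
  LinearMap.mkContinuous
    { toFun := fun f => ∑' s, f.coeff s • v s
      map_add' := fun f g => by
        simp only [coeff_add, add_smul]
        exact (summable_lift v C hv f).tsum_add (summable_lift v C hv g)
      map_smul' := fun c f => by
        simp only [coeff_smul, mul_smul, RingHom.id_apply]
        exact (summable_lift v C hv f).tsum_const_smul c }
    C (fun f => by
      refine tsum_of_norm_bounded (f.hasSum_norm_coeff.mul_left C) fun s => ?_
      rw [norm_smul, mul_comm]
      exact mul_le_mul_of_nonneg_right (hv s) (norm_nonneg _))

theorem lift_apply (v : {s : S // s ≠ 0} → E) (C : ℝ) (hv : ∀ s, ‖v s‖ ≤ C) (f : ReducedL1 S) :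
    lift v C hv f = ∑' s, f.coeff s • v s := rfl

theorem norm_lift_le (v : {s : S // s ≠ 0} → E) {C : ℝ} (hC : 0 ≤ C) (hv : ∀ s, ‖v s‖ ≤ C) :
    ‖lift v C hv‖ ≤ C :=
  LinearMap.mkContinuous_norm_le _ hC _

theorem lift_delta (v : {s : S // s ≠ 0} → E) (C : ℝ) (hv : ∀ s, ‖v s‖ ≤ C)
    (s : {s : S // s ≠ 0}) : lift v C hv (delta s.1) = v s := by
  classical
  rw [lift_apply, tsum_eq_single s]
  · simp [coeff_delta]
  · intro t ht; simp [coeff_delta, ht]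

end Lift

section Product

variable {S : Type*} [MonoidWithZero S]

/-- The product `#`: the bilinear continuous extension of `δ_s # δ_t = δ_{st}` if `st ≠ ◇`, and
`δ_s # δ_t = 0` if `st = ◇`, i.e. `f # g = ∑_s ∑_t f(s) g(t) δ_{st}` with `δ_◇ = 0`. -/
instance : Mul (ReducedL1 S) :=
  ⟨fun f g => ∑' s, f.coeff s • ∑' t, g.coeff t • delta (s.1 * t.1)⟩

/-- The unit `δ_e`. -/
instance : One (ReducedL1 S) := ⟨delta 1⟩

theorem mul_def (f g : ReducedL1 S) :
    f * g = ∑' s, f.coeff s • ∑' t, g.coeff t • delta (s.1 * t.1) := rfl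

theorem one_def : (1 : ReducedL1 S) = delta 1 := rfl

/-- The product as a bounded bilinear map. -/
def mulCLM : ReducedL1 S →L[ℂ] ReducedL1 S →L[ℂ] ReducedL1 S :=
  lift (fun s => lift (fun t => delta (s.1 * t.1)) 1 fun _ => norm_delta_le _) 1
    fun _ => norm_lift_le _ zero_le_one _

theorem mulCLM_apply (f g : ReducedL1 S) : mulCLM f g = f * g := by
  have h := (summable_lift (fun s : {s : S // s ≠ 0} =>
    lift (fun t => delta (s.1 * t.1)) 1 fun _ => norm_delta_le _) 1
    (fun _ => norm_lift_le _ zero_le_one _) f)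
  have h2 := (ContinuousLinearMap.apply ℂ (ReducedL1 S) g).map_tsum h
  simpa [mulCLM, lift_apply, mul_def] using h2

theorem delta_mul_delta (s t : S) : delta s * delta t = delta (s * t) := by
  by_cases hs : s = 0
  · subst hs; rw [← mulCLM_apply]; simp [delta_zero]
  by_cases ht : t = 0
  · subst ht; rw [← mulCLM_apply]; simp [delta_zero]
  rw [← mulCLM_apply, mulCLM, lift_delta _ _ _ ⟨s, hs⟩, lift_delta _ _ _ ⟨t, ht⟩]

theorem add_mul_aux (f g h : ReducedL1 S) : (f + g) * h = f * h + g * h := by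
  simp only [← mulCLM_apply, map_add, _root_.add_apply]

theorem mul_add_aux (f g h : ReducedL1 S) : f * (g + h) = f * g + f * h := by
  simp only [← mulCLM_apply, map_add]

theorem zero_mul_aux (f : ReducedL1 S) : 0 * f = 0 := by
  simp only [← mulCLM_apply, map_zero, _root_.zero_apply]

theorem mul_zero_aux (f : ReducedL1 S) : f * 0 = 0 := by
  simp only [← mulCLM_apply, map_zero]

theorem smul_mul_aux (c : ℂ) (f g : ReducedL1 S) : (c • f) * g = c • (f * g) := by
  simp only [← mulCLM_apply, map_smul, _root_.smul_apply]

theorem mul_smul_aux (c : ℂ) (f g : ReducedL1 S) : f * (c • g) = c • (f * g) := by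
  simp only [← mulCLM_apply, map_smul]

theorem continuous_mul_aux :
    Continuous fun p : ReducedL1 S × ReducedL1 S => p.1 * p.2 := by
  simp only [← mulCLM_apply]
  fun_prop

theorem norm_mul_aux (f g : ReducedL1 S) : ‖f * g‖ ≤ ‖f‖ * ‖g‖ := by
  have h : ‖(mulCLM : ReducedL1 S →L[ℂ] _)‖ ≤ 1 := norm_lift_le _ zero_le_one _
  rw [← mulCLM_apply]
  refine (ContinuousLinearMap.le_opNorm₂ _ _ _).trans ?_
  calc ‖(mulCLM : ReducedL1 S →L[ℂ] _)‖ * ‖f‖ * ‖g‖ ≤ 1 * ‖f‖ * ‖g‖ := by gcongr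
    _ = ‖f‖ * ‖g‖ := by ring

theorem cont_mul_left (g : ReducedL1 S) : Continuous fun f : ReducedL1 S => f * g :=
  continuous_mul_aux.comp (continuous_id.prodMk continuous_const)

theorem cont_mul_right (f : ReducedL1 S) : Continuous fun g : ReducedL1 S => f * g :=
  continuous_mul_aux.comp (continuous_const.prodMk continuous_id)

theorem mul_assoc_aux (f g h : ReducedL1 S) : f * g * h = f * (g * h) := by
  revert f
  refine induction_delta ?_ ?_ ?_ ?_
  · exact isClosed_eq ((cont_mul_left h).comp (cont_mul_left g)) (cont_mul_left _)
  · simp only [zero_mul_aux]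
  · intro f₁ f₂ h₁ h₂; simp only [add_mul_aux, h₁, h₂]
  intro c s
  simp only [smul_mul_aux]
  congr 1
  revert g
  refine induction_delta ?_ ?_ ?_ ?_
  · exact isClosed_eq ((cont_mul_left h).comp (cont_mul_right _))
      ((cont_mul_right _).comp (cont_mul_left h))
  · simp only [zero_mul_aux, mul_zero_aux]
  · intro f₁ f₂ h₁ h₂; simp only [add_mul_aux, mul_add_aux, h₁, h₂]
  intro d t
  simp only [smul_mul_aux, mul_smul_aux]
  congr 1
  revert h
  refine induction_delta ?_ ?_ ?_ ?_
  · exact isClosed_eq (cont_mul_right _) ((cont_mul_right _).comp (cont_mul_right _))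
  · simp only [mul_zero_aux]
  · intro f₁ f₂ h₁ h₂; simp only [mul_add_aux, h₁, h₂]
  intro e u
  simp only [mul_smul_aux, delta_mul_delta, mul_assoc]

theorem one_mul_aux (f : ReducedL1 S) : 1 * f = f := by
  revert f
  refine induction_delta ?_ ?_ ?_ ?_
  · exact isClosed_eq (cont_mul_right _) continuous_id
  · simp only [mul_zero_aux]
  · intro f₁ f₂ h₁ h₂; simp only [mul_add_aux, h₁, h₂]
  intro c s
  simp only [mul_smul_aux, one_def, delta_mul_delta, one_mul]

theorem mul_one_aux (f : ReducedL1 S) : f * 1 = f := by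
  revert f
  refine induction_delta ?_ ?_ ?_ ?_
  · exact isClosed_eq (cont_mul_left _) continuous_id
  · simp only [zero_mul_aux]
  · intro f₁ f₂ h₁ h₂; simp only [add_mul_aux, h₁, h₂]
  intro c s
  simp only [smul_mul_aux, one_def, delta_mul_delta, mul_one]

instance : Ring (ReducedL1 S) :=
  { (inferInstance : AddCommGroup (ReducedL1 S)) with
    mul := (· * ·)
    one := 1
    mul_assoc := mul_assoc_aux
    one_mul := one_mul_aux
    mul_one := mul_one_aux
    left_distrib := mul_add_aux
    right_distrib := add_mul_aux
    zero_mul := zero_mul_aux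
    mul_zero := mul_zero_aux }

instance : NormedRing (ReducedL1 S) :=
  { (inferInstance : Ring (ReducedL1 S)), (inferInstance : NormedAddCommGroup (ReducedL1 S)) with
    norm_mul_le := norm_mul_aux }

instance : Algebra ℂ (ReducedL1 S) := Algebra.ofModule smul_mul_aux mul_smul_aux

instance : NormedAlgebra ℂ (ReducedL1 S) :=
  { (inferInstance : Algebra ℂ (ReducedL1 S)) with
    norm_smul_le := norm_smul_le }

end Product

section Involution

variable {S : Type*} [MonoidWithZero S] [StarMul S]

theorem star_zero_aux : star (0 : S) = 0 := by
  have h : star (star (0 : S) * 0) = star (0 : S) := by rw [mul_zero]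
  rw [star_mul, star_star, mul_zero] at h
  simpa using h.symm

/-- The involution of `S`, restricted to the nonzero elements. -/
def starNonzero : {s : S // s ≠ 0} ≃ {s : S // s ≠ 0} where
  toFun s := ⟨star s.1, fun h => s.2 (by rw [← star_star s.1, h, star_zero_aux])⟩
  invFun s := ⟨star s.1, fun h => s.2 (by rw [← star_star s.1, h, star_zero_aux])⟩
  left_inv s := Subtype.ext (star_star s.1)
  right_inv s := Subtype.ext (star_star s.1)

/-- The involution `f*(s) = conj (f (s*))`. -/
instance : Star (ReducedL1 S) :=
  ⟨fun f => ⟨fun s => starRingEnd ℂ (f.coeff (starNonzero s)), memℓp_gen (by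
    have h := (starNonzero (S := S)).summable_iff.2 f.hasSum_norm_coeff.summable
    simpa [Function.comp_def] using h)⟩⟩

theorem coeff_star (f : ReducedL1 S) (s : {s : S // s ≠ 0}) :
    (star f).coeff s = starRingEnd ℂ (f.coeff (starNonzero s)) := rfl

theorem norm_star_eq (f : ReducedL1 S) : ‖star f‖ = ‖f‖ := by
  have h := (starNonzero (S := S)).hasSum_iff.2 f.hasSum_norm_coeff
  refine (star f).hasSum_norm_coeff.unique ?_
  simpa [coeff_star, Function.comp_def] using h

theorem star_star_aux (f : ReducedL1 S) : star (star f) = f := by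
  refine ext_coeff fun s => ?_
  have h : starNonzero (starNonzero s) = s := (starNonzero (S := S)).left_inv s
  simp [coeff_star, h]

theorem star_add_aux (f g : ReducedL1 S) : star (f + g) = star f + star g := by
  refine ext_coeff fun s => ?_
  simp [coeff_star, coeff_add]

theorem star_smul_aux (c : ℂ) (f : ReducedL1 S) : star (c • f) = star c • star f := by
  refine ext_coeff fun s => ?_
  simp [coeff_star, coeff_smul]

theorem star_delta (s : S) : star (delta s) = delta (star s) := by
  classical
  by_cases h : s = 0
  · subst h
    rw [star_zero_aux, delta_zero]
    refine ext_coeff fun s => ?_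
    change starRingEnd ℂ 0 = 0
    simp
  · refine ext_coeff fun t => ?_
    have h1 := coeff_delta (⟨s, h⟩ : {s : S // s ≠ 0}) (starNonzero t)
    have h2 := coeff_delta (starNonzero (⟨s, h⟩ : {s : S // s ≠ 0})) t
    change (delta (star s)).coeff t = _ at h2
    rw [coeff_star, h1, h2]
    have h3 : (starNonzero t = ⟨s, h⟩) ↔ t = starNonzero ⟨s, h⟩ := by
      constructor
      · intro h'; rw [← h']; exact ((starNonzero (S := S)).left_inv t).symm
      · intro h'; rw [h']; exact (starNonzero (S := S)).left_inv _
    by_cases h4 : t = starNonzero ⟨s, h⟩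
    · rw [if_pos (h3.2 h4), if_pos h4, map_one]
    · rw [if_neg fun h5 => h4 (h3.1 h5), if_neg h4, map_zero]

theorem continuous_star_aux : Continuous (star : ReducedL1 S → ReducedL1 S) := by
  refine AddMonoidHomClass.continuous_of_bound (AddMonoidHom.mk' (star : ReducedL1 S → ReducedL1 S)
    star_add_aux) 1 fun f => ?_
  rw [one_mul]
  exact (norm_star_eq f).le

theorem star_mul_aux (f g : ReducedL1 S) : star (f * g) = star g * star f := by
  have h0 : star (0 : ReducedL1 S) = 0 := by
    have := star_add_aux (0 : ReducedL1 S) 0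
    simpa using this
  revert f
  refine induction_delta ?_ ?_ ?_ ?_
  · exact isClosed_eq (continuous_star_aux.comp (continuous_mul_const g))
      ((continuous_const_mul _).comp continuous_star_aux)
  · simp [h0]
  · intro f₁ f₂ h₁ h₂; simp only [add_mul, star_add_aux, mul_add, h₁, h₂]
  intro c s
  simp only [smul_mul_assoc, star_smul_aux, mul_smul_comm]
  congr 1
  revert g
  refine induction_delta ?_ ?_ ?_ ?_
  · exact isClosed_eq (continuous_star_aux.comp (continuous_const_mul _))
      ((continuous_mul_const _).comp continuous_star_aux)
  · simp [h0]
  · intro f₁ f₂ h₁ h₂; simp only [add_mul, star_add_aux, mul_add, h₁, h₂]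
  intro d t
  simp only [smul_mul_assoc, star_smul_aux, mul_smul_comm, delta_mul_delta, star_delta, star_mul]

instance : StarRing (ReducedL1 S) where
  star_involutive := star_star_aux
  star_mul := star_mul_aux
  star_add := star_add_aux

instance : StarModule ℂ (ReducedL1 S) := ⟨star_smul_aux⟩

instance : NormedStarGroup (ReducedL1 S) := ⟨fun f => (norm_star_eq f).le⟩

end Involution

end

end ReducedL1

/-! ### The Cuntz semigroup `Cu₂` -/

/-- The generators `s₁, s₂, s₁*, s₂*`. -/
inductive CuntzGen : Type
  | s (i : Fin 2)
  | sStar (i : Fin 2)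

/-- Words in the generators, together with a zero element. -/
abbrev CuntzWord : Type := WithZero (FreeMonoid CuntzGen)

/-- A generator as a one-letter word. -/
def CuntzGen.word (x : CuntzGen) : CuntzWord := ((FreeMonoid.of x : FreeMonoid CuntzGen) : CuntzWord)

/-- The defining relations `sᵢ* sᵢ = e` and `sᵢ* sⱼ = ◇` for `i ≠ j`. -/
inductive CuntzRel : CuntzWord → CuntzWord → Prop
  | same (i : Fin 2) : CuntzRel ((CuntzGen.sStar i).word * (CuntzGen.s i).word) 1
  | diff (i j : Fin 2) (h : i ≠ j) : CuntzRel ((CuntzGen.sStar i).word * (CuntzGen.s j).word) 0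

/-- The Cuntz semigroup (polycyclic monoid) `Cu₂`: the monoid with zero presented by the generators
`s₁, s₂, s₁*, s₂*` and the above relations. -/
def Cu2 : Type := (conGen CuntzRel).Quotient

namespace Cu2

instance : Monoid Cu2 := inferInstanceAs (Monoid (conGen CuntzRel).Quotient)

/-- The class of a word. -/
def mk : CuntzWord →* Cu2 := (conGen CuntzRel).mk'

theorem mk_surjective : Function.Surjective mk := Con.mk'_surjective

instance : MonoidWithZero Cu2 :=
  { (inferInstance : Monoid Cu2) with
    zero := mk 0
    zero_mul := fun a => by
      obtain ⟨w, rfl⟩ := mk_surjective a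
      change mk 0 * mk w = mk 0
      rw [← map_mul, zero_mul]
    mul_zero := fun a => by
      obtain ⟨w, rfl⟩ := mk_surjective a
      change mk w * mk 0 = mk 0
      rw [← map_mul, mul_zero] }

theorem mk_zero : mk 0 = 0 := rfl

/-- The generators `s₁, s₂` (indexed by `0, 1 : Fin 2`). -/
def s (i : Fin 2) : Cu2 := mk (CuntzGen.s i).word

/-- The generators `s₁*, s₂*`. -/
def sStar (i : Fin 2) : Cu2 := mk (CuntzGen.sStar i).word

theorem sStar_mul_s_same (i : Fin 2) : sStar i * s i = 1 := by
  rw [sStar, s, ← map_mul, ← map_one mk]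
  exact (Con.eq _).2 (ConGen.Rel.of _ _ (CuntzRel.same i))

theorem sStar_mul_s_diff (i j : Fin 2) (h : i ≠ j) : sStar i * s j = 0 := by
  rw [sStar, s, ← map_mul, ← mk_zero]
  exact (Con.eq _).2 (ConGen.Rel.of _ _ (CuntzRel.diff i j h))

/-- `sᵢ ↦ sᵢ*` and `sᵢ* ↦ sᵢ`, with values in the opposite monoid. -/
def starGen : CuntzGen → Cu2ᵐᵒᵖ
  | CuntzGen.s i => MulOpposite.op (sStar i)
  | CuntzGen.sStar i => MulOpposite.op (s i)

/-- The anti-homomorphism of words which reverses words and exchanges `sᵢ` and `sᵢ*`. -/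
def starWord : CuntzWord →*₀ Cu2ᵐᵒᵖ := WithZero.lift' (FreeMonoid.lift starGen)

theorem starWord_word (x : CuntzGen) : starWord x.word = starGen x := by
  simp [starWord, CuntzGen.word]

theorem starWord_respects : conGen CuntzRel ≤ Con.ker (starWord : CuntzWord →* Cu2ᵐᵒᵖ) := by
  refine Con.conGen_le.2 fun x y h => ?_
  rw [Con.ker_rel]
  change starWord x = starWord y
  cases h with
  | same i =>
    rw [map_mul, map_one, starWord_word, starWord_word]
    change MulOpposite.op (sStar i * s i) = 1
    rw [sStar_mul_s_same]; rfl
  | diff i j h =>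
    rw [map_mul, map_zero, starWord_word, starWord_word]
    change MulOpposite.op (sStar j * s i) = 0
    rw [sStar_mul_s_diff _ _ h.symm]; rfl

/-- The involution of `Cu₂`, as a homomorphism to the opposite monoid. -/
def starHom : Cu2 →* Cu2ᵐᵒᵖ :=
  (conGen CuntzRel).lift (starWord : CuntzWord →* Cu2ᵐᵒᵖ) starWord_respects

theorem starHom_mk (w : CuntzWord) : starHom (mk w) = starWord w := rfl

theorem starHom_s (i : Fin 2) : starHom (s i) = MulOpposite.op (sStar i) := by
  rw [s, starHom_mk, starWord_word]; rfl

theorem starHom_sStar (i : Fin 2) : starHom (sStar i) = MulOpposite.op (s i) := by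
  rw [sStar, starHom_mk, starWord_word]; rfl

theorem starHom_starHom (a : Cu2) : (starHom (starHom a).unop).unop = a := by
  obtain ⟨w, rfl⟩ := mk_surjective a
  induction w using WithZero.recZeroCoe with
  | zero =>
    have h : starHom (mk 0) = MulOpposite.op (mk 0) := by
      rw [starHom_mk, map_zero]; rfl
    rw [h, MulOpposite.unop_op, h, MulOpposite.unop_op]
  | coe w =>
    induction w using FreeMonoid.inductionOn' with
    | one =>
      change (starHom (starHom (mk 1)).unop).unop = mk 1
      simp
    | of_mul x w ih =>
      rw [WithZero.coe_mul, map_mul, map_mul, MulOpposite.unop_mul, map_mul,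
        MulOpposite.unop_mul, ih]
      congr 1
      cases x with
      | s i => change (starHom (starHom (s i)).unop).unop = s i; simp [starHom_s, starHom_sStar]
      | sStar i =>
        change (starHom (starHom (sStar i)).unop).unop = sStar i
        simp [starHom_s, starHom_sStar]

/-- The involution `t ↦ t*` of `Cu₂`, determined by `(sᵢ)* = sᵢ*`. -/
instance : StarMul Cu2 where
  star a := (starHom a).unop
  star_involutive := starHom_starHom
  star_mul a b := by rw [map_mul, MulOpposite.unop_mul]

theorem star_s (i : Fin 2) : star (s i) = sStar i := by
  change (starHom (s i)).unop = _
  rw [starHom_s, MulOpposite.unop_op]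

end Cu2

/-! ### The quotient algebra `𝒜 / 𝒥` -/

/-- The Banach `*`-algebra `𝒜 = (ℓ¹(Cu₂ \ {◇}), #)`. -/
abbrev CuntzL1 : Type := ReducedL1 Cu2

namespace CuntzL1

noncomputable section

/-- The element `f₀ = δ_e - δ_{s₁ s₁*} - δ_{s₂ s₂*}`. -/
def f₀ : CuntzL1 :=
  ReducedL1.delta 1 - ReducedL1.delta (Cu2.s 0 * star (Cu2.s 0))
    - ReducedL1.delta (Cu2.s 1 * star (Cu2.s 1))

/-- The closed two-sided ideal `𝒥` generated by `f₀`: the intersection of all closed two-sided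
ideals containing `f₀`. -/
def J : Ideal CuntzL1 :=
  sInf {I : Ideal CuntzL1 | I.IsTwoSided ∧ IsClosed (I : Set CuntzL1) ∧ f₀ ∈ I}

theorem mem_J {x : CuntzL1} :
    x ∈ J ↔ ∀ I : Ideal CuntzL1, I.IsTwoSided → IsClosed (I : Set CuntzL1) → f₀ ∈ I → x ∈ I := by
  simp [J, Submodule.mem_sInf]

instance : J.IsTwoSided :=
  ⟨fun b ha => mem_J.2 fun I h₁ h₂ h₃ => I.mul_mem_right b (mem_J.1 ha I h₁ h₂ h₃)⟩

instance : IsClosed (J : Set CuntzL1) := by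
  have h : (J : Set CuntzL1) = ⋂ I ∈ {I : Ideal CuntzL1 | I.IsTwoSided ∧
      IsClosed (I : Set CuntzL1) ∧ f₀ ∈ I}, (I : Set CuntzL1) := by
    simp [J, Submodule.coe_sInf]
  rw [h]
  exact isClosed_biInter fun I hI => hI.2.1

theorem star_f₀ : star f₀ = f₀ := by
  simp [f₀, ReducedL1.star_delta]

theorem star_mem_J {x : CuntzL1} (hx : x ∈ J) : star x ∈ J := by
  refine mem_J.2 fun I h₁ h₂ h₃ => ?_
  let I' : Ideal CuntzL1 :=
    { carrier := {y | star y ∈ I}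
      add_mem' := fun {a b} ha hb => by
        simpa [star_add] using I.add_mem ha hb
      zero_mem' := by simp
      smul_mem' := fun c y hy => by
        simpa [star_mul] using I.mul_mem_right (star c) hy }
  have h' : I'.IsTwoSided := ⟨fun {a} b ha => by
    change star (a * b) ∈ I
    rw [star_mul]
    exact I.mul_mem_left _ ha⟩
  exact mem_J.1 hx I' h' (h₂.preimage continuous_star) (by change star f₀ ∈ I; rwa [star_f₀])

end

end CuntzL1

/-- The quotient `𝒜 / 𝒥`, with the quotient norm and the induced product and involution. -/
abbrev CuntzQuotient : Type := CuntzL1 ⧸ CuntzL1.J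

namespace CuntzQuotient

noncomputable section

theorem norm_mul_le_aux (x y : CuntzQuotient) : ‖x * y‖ ≤ ‖x‖ * ‖y‖ := by
  have key : ∀ ε > 0, ‖x * y‖ ≤ (‖x‖ + ε) * (‖y‖ + ε) := by
    intro ε hε
    obtain ⟨a, rfl, ha⟩ := Submodule.Quotient.norm_mk_lt x hε
    obtain ⟨b, rfl, hb⟩ := Submodule.Quotient.norm_mk_lt y hε
    refine (Submodule.Quotient.norm_mk_le (S := CuntzL1.J) (a * b)).trans ?_
    refine (norm_mul_le a b).trans ?_
    gcongr
  have hc : Filter.Tendsto (fun ε : ℝ => (‖x‖ + ε) * (‖y‖ + ε)) (nhdsWithin 0 (Set.Ioi 0))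
      (nhds ((‖x‖ + 0) * (‖y‖ + 0))) :=
    (Continuous.tendsto (by fun_prop) 0).mono_left nhdsWithin_le_nhds
  rw [add_zero, add_zero] at hc
  exact ge_of_tendsto hc (eventually_nhdsWithin_of_forall key)

instance : NormedRing CuntzQuotient :=
  { Ideal.Quotient.ring CuntzL1.J, Submodule.Quotient.normedAddCommGroup CuntzL1.J with
    norm_mul_le := norm_mul_le_aux }

instance : NormedAlgebra ℂ CuntzQuotient :=
  { Submodule.Quotient.normedSpace CuntzL1.J ℂ, Ideal.Quotient.algebra ℂ with }

/-- The involution `(f + 𝒥)* = f* + 𝒥`. -/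
instance : Star CuntzQuotient :=
  ⟨fun x => Quotient.liftOn' x (fun f => Ideal.Quotient.mk CuntzL1.J (star f)) fun a b h => by
    have h' : a - b ∈ CuntzL1.J := (Submodule.quotientRel_def _).1 h
    refine Ideal.Quotient.eq.2 ?_
    rw [← star_sub]
    exact CuntzL1.star_mem_J h'⟩

theorem star_mk (f : CuntzL1) :
    star (Ideal.Quotient.mk CuntzL1.J f) = Ideal.Quotient.mk CuntzL1.J (star f) := rfl

end

end CuntzQuotient

/-! ### The properties -/

/-- A unital normed algebra with a map `*` is a (unital) Banach `*`-algebra: it is complete, the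
unit has norm one, and `*` is an isometric conjugate-linear involution reversing products.
(Submultiplicativity of the norm is part of `NormedRing`.) -/
structure IsBanachStarAlgebra (B : Type*) [NormedRing B] [NormedAlgebra ℂ B] [Star B] : Prop where
  complete : CompleteSpace B
  norm_one : ‖(1 : B)‖ = 1
  star_star : ∀ x : B, star (star x) = x
  star_add : ∀ x y : B, star (x + y) = star x + star y
  star_smul : ∀ (c : ℂ) (x : B), star (c • x) = starRingEnd ℂ c • star x
  star_mul : ∀ x y : B, star (x * y) = star y * star x
  norm_star : ∀ x : B, ‖star x‖ = ‖x‖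

/-- A complex unital algebra is purely infinite if it is not a division algebra and for every
nonzero `a` there are `b, c` with `b a c = 1`. (The first clause gives a nonzero noninvertible
element, so the zero algebra is not purely infinite.) -/
structure IsPurelyInfinite (B : Type*) [Ring B] [Algebra ℂ B] : Prop where
  not_division : ¬ ∀ a : B, a ≠ 0 → IsUnit a
  factor : ∀ a : B, a ≠ 0 → ∃ b c : B, b * a * c = 1

/-! In the quotient the generators become contractions S_i, T_i forming a Cuntz family, and every
element a is an absolutely convergent sum of terms c_p S_u T_v over pairs p = (u, v) of words. Words
are stored so that their head letters meet in the middle of S_u T_v. Inserting ∑ S_i T_i = 1 there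
replaces a pair by two pairs whose level, the length of the shorter word, is one higher.

Let a ≠ 0. Choose n so that the coefficients above level n have mass less than ‖a‖/2, and push all
lower pairs up to level n (`exists_expansion_level_ge`). The tail is unchanged, so layer n has mass
greater than ‖a‖/2. By pigeonhole (`exists_tsum_fiber_lt`) some q = (x, y) in that layer has |c_q|
larger than the mass of all higher pairs that truncate to q. Compress a by T_1 T_0^m T_x on the left
and S_y S_0^m S_1 on the right. The word of q becomes 1. A pair with the same degree |u| - |v| as q
survives only if it truncates to q (`compression_of_truncPair_ne`). A pair of another degree dies
once m is large (`compression_offDegree`), and dominated convergence makes the total off-degree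
error small. Hence the compression of a is at distance less than |c_q| from c_q · 1, so it is
invertible.

That the quotient is nonzero needs a concrete Cuntz family: one acting on bounded sequences yields a
continuous homomorphism that kills f₀ but not 1. Then S_0 has a left inverse but is not a unit,
since T_1 S_0 = 0; this excludes both division algebras and finite dimension. -/

open Filter Topology

/-! ### Words in a Cuntz family and their cancellations -/

/-- Elements `S i`, `T i` of a ring which satisfy the Cuntz relations. -/
structure IsCuntzFamily {B : Type*} [Ring B] (S T : Fin 2 → B) : Prop where
  mul_self : ∀ i, T i * S i = 1
  mul_of_ne : ∀ i j, i ≠ j → T i * S j = 0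
  sum_eq : ∑ i, S i * T i = 1

/-- The product of the letters of `w`, in reverse order. -/
def revProd {M : Type*} [Monoid M] (S : Fin 2 → M) : List (Fin 2) → M
  | [] => 1
  | i :: w => revProd S w * S i

/-- The product of the letters of `w`. -/
def listProd {M : Type*} [Monoid M] (T : Fin 2 → M) : List (Fin 2) → M
  | [] => 1
  | i :: w => T i * listProd T w

section Words

variable {M : Type*} [Monoid M] (S T : Fin 2 → M)

theorem revProd_append (u v : List (Fin 2)) :
    revProd S (u ++ v) = revProd S v * revProd S u := by
  induction u with
  | nil => simp [revProd]
  | cons i u ih => simp [revProd, ih, mul_assoc]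

theorem listProd_append (u v : List (Fin 2)) :
    listProd T (u ++ v) = listProd T u * listProd T v := by
  induction u with
  | nil => simp [listProd]
  | cons i u ih => simp [listProd, ih, mul_assoc]

theorem map_revProd {N : Type*} [Monoid N] (φ : M →* N) (w : List (Fin 2)) :
    φ (revProd S w) = revProd (fun i => φ (S i)) w := by
  induction w with
  | nil => simp [revProd]
  | cons i u ih => simp [revProd, ih]

theorem map_listProd {N : Type*} [Monoid N] (φ : M →* N) (w : List (Fin 2)) :
    φ (listProd T w) = listProd (fun i => φ (T i)) w := by
  induction w with
  | nil => simp [listProd]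
  | cons i u ih => simp [listProd, ih]

end Words

namespace IsCuntzFamily

section Algebraic

variable {B : Type*} [Ring B] {S T : Fin 2 → B} (h : IsCuntzFamily S T)
include h

theorem listProd_mul_revProd_self (u : List (Fin 2)) : listProd T u * revProd S u = 1 := by
  induction u with
  | nil => simp [revProd, listProd]
  | cons i u ih =>
    rw [listProd, revProd, mul_assoc, ← mul_assoc (listProd T u), ih, one_mul, h.mul_self]

theorem listProd_mul_revProd_of_length_eq {u v : List (Fin 2)} (hl : u.length = v.length)
    (hne : u ≠ v) : listProd T u * revProd S v = 0 := by
  induction u generalizing v with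
  | nil => cases v <;> simp_all
  | cons i u ih =>
    cases v with
    | nil => simp at hl
    | cons j v =>
      rw [listProd, revProd, mul_assoc, ← mul_assoc (listProd T u)]
      by_cases huv : u = v
      · subst huv
        rw [h.listProd_mul_revProd_self, one_mul, h.mul_of_ne]
        rintro rfl; exact hne rfl
      · rw [ih (by simpa using hl) huv]; simp

/-- `T_w S_u` vanishes for `|u| ≤ |w|` unless `u` is an end segment of `w`. -/
theorem listProd_mul_revProd_of_le {w u : List (Fin 2)} (hl : u.length ≤ w.length) :
    listProd T w * revProd S u =
      if w.drop (w.length - u.length) = u then listProd T (w.take (w.length - u.length)) else 0 := by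
  conv_lhs => rw [← List.take_append_drop (w.length - u.length) w, listProd_append, mul_assoc]
  split_ifs with hu
  · rw [hu, h.listProd_mul_revProd_self, mul_one]
  · rw [h.listProd_mul_revProd_of_length_eq (by rw [List.length_drop]; omega) hu, mul_zero]

theorem listProd_mul_revProd_of_ge {w u : List (Fin 2)} (hl : w.length ≤ u.length) :
    listProd T w * revProd S u =
      if u.drop (u.length - w.length) = w then revProd S (u.take (u.length - w.length)) else 0 := by
  conv_lhs => rw [← List.take_append_drop (u.length - w.length) u, revProd_append, ← mul_assoc]
  split_ifs with hu
  · rw [hu, h.listProd_mul_revProd_self, one_mul]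
  · rw [h.listProd_mul_revProd_of_length_eq (by rw [List.length_drop]; omega) (Ne.symm hu),
      zero_mul]

/-- Head letters sit in the middle of S_u T_v, so lengthening both words by i inserts S_i T_i there,
and these sum to 1. This is the only use of the sum relation in the factorization argument. -/
theorem sum_cons (u v : List (Fin 2)) :
    ∑ i, revProd S (i :: u) * listProd T (i :: v) = revProd S u * listProd T v := by
  have : ∀ i, revProd S (i :: u) * listProd T (i :: v) =
      revProd S u * (S i * T i) * listProd T v := fun i => by
    simp only [revProd, listProd, mul_assoc]
  simp only [this]
  rw [← Finset.sum_mul, ← Finset.mul_sum, h.sum_eq, mul_one]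

/-- Two words whose first letters agree with `1 0 ⋯ 0` are orthogonal when they have different
lengths and the block of zeros is long enough. -/
theorem listProd_mul_revProd_marked {w w' : List (Fin 2)} (hne : w.length ≠ w'.length)
    {m : ℕ} (hw : ∀ k < w.length, k ≤ m → w[k]? = some (if k = 0 then 1 else 0))
    (hw' : ∀ k < w'.length, k ≤ m → w'[k]? = some (if k = 0 then 1 else 0))
    (h0 : w ≠ []) (h0' : w' ≠ [])
    (hm : w.length ≤ w'.length + m) (hm' : w'.length ≤ w.length + m) :
    listProd T w * revProd S w' = 0 := by
  rcases lt_or_gt_of_ne hne with hlt | hlt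
  · rw [h.listProd_mul_revProd_of_ge hlt.le, if_neg]
    intro he
    -- If w were an end segment of w', its leading 1 would sit at position |w'| - |w| of w', which
    -- lies between 1 and m, where w' carries a 0.
    have h1 := congrArg (fun l => l[0]?) he
    have hpos := List.length_pos_of_ne_nil h0
    simp only [List.getElem?_drop, add_zero] at h1
    rw [hw 0 hpos (Nat.zero_le _), hw' _ (by omega) (by omega), if_neg (by omega)] at h1
    simp at h1
  · rw [h.listProd_mul_revProd_of_le hlt.le, if_neg]
    intro he
    have h1 := congrArg (fun l => l[0]?) he
    have hpos := List.length_pos_of_ne_nil h0'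
    simp only [List.getElem?_drop, add_zero] at h1
    rw [hw' 0 hpos (Nat.zero_le _), hw _ (by omega) (by omega), if_neg (by omega)] at h1
    simp at h1

/-- Compression by a long marked block annihilates the words `S_u T_v` of the wrong degree. -/
theorem compression_offDegree {x y u v : List (Fin 2)}
    (hne : x.length + v.length ≠ y.length + u.length) {m : ℕ}
    (hm : x.length + y.length + u.length + v.length ≤ m) :
    listProd T (1 :: List.replicate m 0 ++ x) * (revProd S u * listProd T v) *
      revProd S (1 :: List.replicate m 0 ++ y) = 0 := by
  rw [← mul_assoc, mul_assoc]
  rw [h.listProd_mul_revProd_of_le (by simp; omega), h.listProd_mul_revProd_of_ge (by simp; omega)]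
  split_ifs <;> try simp
  -- In the one surviving case, S_u and T_v have been absorbed by the outer words, leaving initial
  -- segments of them that still begin with 1 0 ⋯ 0. Their lengths differ because the degrees do.
  have key : ∀ (z : List (Fin 2)) (j k : ℕ), k ≤ m → k < j →
      ((1 :: List.replicate m 0 ++ z).take j)[k]? = some (if k = 0 then (1 : Fin 2) else 0) := by
    intro z j k hk hkj
    rw [List.getElem?_take_of_lt hkj]
    cases k with
    | zero => simp
    | succ k =>
      rw [List.cons_append, List.getElem?_cons_succ, List.getElem?_append_left (by simp; omega)]
      simp [List.getElem?_replicate]; omega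
  refine h.listProd_mul_revProd_marked (m := m) ?_ ?_ ?_ ?_ ?_ ?_ ?_
  · simp; omega
  · intro k hk hkm; exact key _ _ _ hkm (lt_of_lt_of_le hk (List.length_take_le _ _))
  · intro k hk hkm; exact key _ _ _ hkm (lt_of_lt_of_le hk (List.length_take_le _ _))
  · apply List.ne_nil_of_length_pos; simp; omega
  · apply List.ne_nil_of_length_pos; simp; omega
  · simp; omega
  · simp; omega

end Algebraic

end IsCuntzFamily

/-! ### Pairs of words, levels and truncation -/

/-- The element `S_u T_v` for a pair `p = (u, v)` of words. -/
def wordPair {M : Type*} [Monoid M] (S T : Fin 2 → M) (p : List (Fin 2) × List (Fin 2)) : M :=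
  revProd S p.1 * listProd T p.2

/-- The length of the shorter word of a pair. -/
def wordLevel (p : List (Fin 2) × List (Fin 2)) : ℕ := min p.1.length p.2.length

/-- Lengthening both words of a pair by the same letter. -/
def consPair (i : Fin 2) (p : List (Fin 2) × List (Fin 2)) : List (Fin 2) × List (Fin 2) :=
  (i :: p.1, i :: p.2)

/-- Shortening both words of a pair equally, down to level `n`. -/
def truncPair (n : ℕ) (p : List (Fin 2) × List (Fin 2)) : List (Fin 2) × List (Fin 2) :=
  (p.1.drop (wordLevel p - n), p.2.drop (wordLevel p - n))

theorem consPair_injective (i : Fin 2) : Function.Injective (consPair i) := by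
  rintro ⟨a, b⟩ ⟨c, d⟩ h
  simpa [consPair] using h

theorem wordLevel_consPair (i : Fin 2) (p) : wordLevel (consPair i p) = wordLevel p + 1 := by
  simp only [wordLevel, consPair, List.length_cons]; omega

/-- Moves norms and scalar multiples inside an extension by zero, so that sums can be reindexed
along an injection. -/
theorem comp_extend_zero {α β E : Type*} [Zero E] {f : α → β} (hf : Function.Injective f)
    (g : α → ℂ) (φ : ℂ → β → E) (hφ : ∀ b, φ 0 b = 0) :
    (fun b => φ (Function.extend f g 0 b) b) = Function.extend f (fun a => φ (g a) (f a)) 0 := by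
  funext b
  by_cases hb : ∃ a, f a = b
  · obtain ⟨a, rfl⟩ := hb
    rw [hf.extend_apply, hf.extend_apply]
  · rw [Function.extend_apply' _ _ _ hb, Function.extend_apply' _ _ _ hb]
    exact hφ b

section Norm

variable {B : Type*} [NormedRing B] {S T : Fin 2 → B}

theorem norm_revProd_le (h1 : ‖(1 : B)‖ ≤ 1) (hS : ∀ i, ‖S i‖ ≤ 1) (w : List (Fin 2)) :
    ‖revProd S w‖ ≤ 1 := by
  induction w with
  | nil => exact h1
  | cons i w ih => exact (norm_mul_le _ _).trans (mul_le_one₀ ih (norm_nonneg _) (hS i))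

theorem norm_listProd_le (h1 : ‖(1 : B)‖ ≤ 1) (hT : ∀ i, ‖T i‖ ≤ 1) (w : List (Fin 2)) :
    ‖listProd T w‖ ≤ 1 := by
  induction w with
  | nil => exact h1
  | cons i w ih => exact (norm_mul_le _ _).trans (mul_le_one₀ (hT i) (norm_nonneg _) ih)

theorem norm_wordPair_le (h1 : ‖(1 : B)‖ ≤ 1) (hS : ∀ i, ‖S i‖ ≤ 1) (hT : ∀ i, ‖T i‖ ≤ 1) (p) :
    ‖wordPair S T p‖ ≤ 1 :=
  (norm_mul_le _ _).trans
    (mul_le_one₀ (norm_revProd_le h1 hS _) (norm_nonneg _) (norm_listProd_le h1 hT _))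

end Norm

namespace IsCuntzFamily

section Algebraic

variable {B : Type*} [Ring B] {S T : Fin 2 → B} (h : IsCuntzFamily S T)
include h

theorem compression_self (x y z : List (Fin 2)) :
    listProd T (z ++ x) * wordPair S T (x, y) * revProd S (z ++ y) = 1 := by
  have := h.listProd_mul_revProd_self
  rw [wordPair, listProd_append, revProd_append]
  calc _ = listProd T z * (listProd T x * revProd S x) * (listProd T y * revProd S y)
        * revProd S z := by simp only [mul_assoc]
    _ = 1 := by rw [this, this, mul_one, mul_one, this]

/-- Equal degree forces both words of p to exceed those of q by the same amount, `wordLevel p - n`.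
The product T_x S_u is nonzero only if u ends in x, and T_v S_y only if v ends in y; together these
say that p truncates to q. -/
theorem compression_of_truncPair_ne {n : ℕ} {p q : List (Fin 2) × List (Fin 2)}
    (hq : wordLevel q = n) (hp : n ≤ wordLevel p)
    (hdeg : q.1.length + p.2.length = q.2.length + p.1.length) (hne : truncPair n p ≠ q)
    (z : List (Fin 2)) :
    listProd T (z ++ q.1) * wordPair S T p * revProd S (z ++ q.2) = 0 := by
  obtain ⟨x, y⟩ := q
  obtain ⟨u, v⟩ := p
  simp only [wordLevel, truncPair, wordPair] at *
  rw [listProd_append, revProd_append]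
  have : listProd T z * listProd T x * (revProd S u * listProd T v) *
      (revProd S y * revProd S z) = listProd T z * ((listProd T x * revProd S u) *
        (listProd T v * revProd S y)) * revProd S z := by simp only [mul_assoc]
  rw [this, h.listProd_mul_revProd_of_ge (by omega), h.listProd_mul_revProd_of_le (by omega)]
  have e1 : u.length - x.length = min u.length v.length - n := by omega
  have e2 : v.length - y.length = min u.length v.length - n := by omega
  rw [e1, e2]
  split_ifs with ha hb
  · exact absurd (Prod.ext ha hb) hne
  all_goals simp

end Algebraic

/-! ### Raising the level of an expansion -/

section Expansion

variable {B : Type*} [NormedRing B] [NormedAlgebra ℂ B] {S T : Fin 2 → B}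
  (h : IsCuntzFamily S T)
include h

/-- An `ℓ¹` expansion in the elements `S_u T_v` can be rewritten so that only pairs of level at
least `n` occur, without changing the coefficients above level `n`. -/
theorem exists_expansion_level_ge (n : ℕ) {a : B} {c : List (Fin 2) × List (Fin 2) → ℂ}
    (hc : Summable fun p => ‖c p‖) (ha : HasSum (fun p => c p • wordPair S T p) a)
    (hs : ∀ g : List (Fin 2) × List (Fin 2) → ℂ, Summable (fun p => ‖g p‖) →
      Summable fun p => g p • wordPair S T p) :
    ∃ d : List (Fin 2) × List (Fin 2) → ℂ, (Summable fun p => ‖d p‖) ∧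
      HasSum (fun p => d p • wordPair S T p) a ∧ (∀ p, wordLevel p < n → d p = 0) ∧
      ∀ p, n < wordLevel p → d p = c p := by
  induction n with
  | zero => exact ⟨c, hc, ha, fun p hp => absurd hp (by omega), fun _ _ => rfl⟩
  | succ n ih =>
    obtain ⟨d, hd, hda, hlow, hhigh⟩ := ih
    -- `g` is the layer at level n, to be moved to level n + 1, and `r` is what stays. Only
    -- coefficients at level n + 1 change, so those strictly above it keep their values.
    set g : List (Fin 2) × List (Fin 2) → ℂ := fun p => if wordLevel p = n then d p else 0 with hg
    set r : List (Fin 2) × List (Fin 2) → ℂ := fun p => if wordLevel p = n then 0 else d p with hr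
    have hgs : Summable fun p => ‖g p‖ := by
      refine Summable.of_nonneg_of_le (fun _ => norm_nonneg _) (fun p => ?_) hd
      simp only [hg]; split_ifs <;> simp
    have hrs : Summable fun p => ‖r p‖ := by
      refine Summable.of_nonneg_of_le (fun _ => norm_nonneg _) (fun p => ?_) hd
      simp only [hr]; split_ifs <;> simp
    have hext : ∀ (i : Fin 2) p, ¬ (wordLevel p = n + 1) →
        Function.extend (consPair i) g 0 p = 0 := by
      intro i p hp
      by_cases hq : ∃ q, consPair i q = p
      · obtain ⟨q, rfl⟩ := hq
        rw [(consPair_injective i).extend_apply]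
        rw [wordLevel_consPair] at hp
        simp only [hg]; rw [if_neg (by omega)]
      · rw [Function.extend_apply' _ _ _ hq]; rfl
    have hexts : ∀ i : Fin 2, Summable fun p => ‖Function.extend (consPair i) g 0 p‖ := by
      intro i
      rw [comp_extend_zero (consPair_injective i) g (fun z _ => ‖z‖)
        (fun _ => norm_zero),
        summable_extend_zero (consPair_injective i)]
      exact hgs
    refine ⟨fun p => r p + ∑ i, Function.extend (consPair i) g 0 p, ?_, ?_, ?_, ?_⟩
    · refine Summable.of_nonneg_of_le (fun _ => norm_nonneg _) (fun p => ?_)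
        (hrs.add (summable_sum (s := Finset.univ) fun i _ => hexts i))
      exact (norm_add_le _ _).trans (add_le_add_right (norm_sum_le _ _) _)
    · have hstep : ∀ i : Fin 2, Summable fun q => g q • wordPair S T (consPair i q) := by
        intro i
        have := hs _ (hexts i)
        rw [comp_extend_zero (consPair_injective i) g (fun z p => z • wordPair S T p)
            (fun _ => zero_smul _ _),
          summable_extend_zero (consPair_injective i)] at this
        exact this
      have hsum : ∀ i : Fin 2, HasSum
          (fun p => Function.extend (consPair i) g 0 p • wordPair S T p)
          (∑' q, g q • wordPair S T (consPair i q)) := by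
        intro i
        rw [comp_extend_zero (consPair_injective i) g (fun z p => z • wordPair S T p)
            (fun _ => zero_smul _ _),
          hasSum_extend_zero (consPair_injective i)]
        exact (hstep i).hasSum
      have hgsum : HasSum (fun q => g q • wordPair S T q)
          (∑ i, ∑' q, g q • wordPair S T (consPair i q)) := by
        refine (hasSum_sum (s := Finset.univ) fun i _ => (hstep i).hasSum).congr_fun ?_ |> id
        intro q
        rw [← Finset.smul_sum]
        congr 1
        exact (h.sum_cons q.1 q.2).symm
      have htot := (hs r hrs).hasSum.add (hasSum_sum (s := Finset.univ) fun i _ => hsum i)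
      -- The rewritten sum still equals a: undoing `sum_cons` on the moved layer gives back r + g =
      -- d.
      have hval : (∑' p, r p • wordPair S T p) +
          ∑ i, ∑' q, g q • wordPair S T (consPair i q) = a := by
        refine ((hs r hrs).hasSum.add hgsum).unique ?_
        convert hda using 2 with p
        rw [← add_smul]
        congr 1
        simp only [hr, hg]; split_ifs <;> simp
      rw [hval] at htot
      convert htot using 2 with p
      rw [add_smul, Finset.sum_smul]
    · intro p hp
      have : r p = 0 := by
        simp only [hr]
        split_ifs with hn
        · rfl
        · exact hlow p (by omega)
      simp only [this, zero_add]
      exact Finset.sum_eq_zero fun i _ => hext i p (by omega)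
    · intro p hp
      have h1 : ∑ i, Function.extend (consPair i) g 0 p = 0 :=
        Finset.sum_eq_zero fun i _ => hext i p (by omega)
      simp only [h1, add_zero, hr]
      rw [if_neg (by omega), hhigh p (by omega)]

end Expansion

end IsCuntzFamily

/-! ### The compression argument -/

/-- Pigeonhole: if `v` has smaller total mass than `w`, then so does some fibre of `t`. -/
theorem exists_tsum_fiber_lt {α β : Type*} {v : α → ℝ} {w : β → ℝ} (hv : Summable v)
    (hw : Summable w) (t : α → β) (hlt : ∑' a, v a < ∑' b, w b) :
    ∃ b, ∑' a : t ⁻¹' {b}, v a < w b := by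
  by_contra! hcon
  have := hv.hasSum.tsum_fiberwise t
  exact absurd (hasSum_le hcon hw.hasSum this) (not_le.2 hlt)

namespace IsCuntzFamily

variable {B : Type*} [NormedRing B] [NormedAlgebra ℂ B] [CompleteSpace B] {S T : Fin 2 → B}
  (h : IsCuntzFamily S T)
include h

/-- A normed algebra spanned in the `ℓ¹` sense by contractive Cuntz words is purely infinite. -/
theorem exists_mul_mul_eq_one (h1 : ‖(1 : B)‖ ≤ 1) (hS : ∀ i, ‖S i‖ ≤ 1) (hT : ∀ i, ‖T i‖ ≤ 1)
    {a : B} (ha0 : a ≠ 0) {c₀ : List (Fin 2) × List (Fin 2) → ℂ}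
    (hc₀ : Summable fun p => ‖c₀ p‖) (ha₀ : HasSum (fun p => c₀ p • wordPair S T p) a) :
    ∃ x y : B, x * a * y = 1 := by
  have hpos : 0 < ‖a‖ := norm_pos_iff.2 ha0
  have hbound : ∀ (z : ℂ) p, ‖z • wordPair S T p‖ ≤ ‖z‖ := fun z p => by
    rw [norm_smul]
    exact mul_le_of_le_one_right (norm_nonneg _) (norm_wordPair_le h1 hS hT p)
  -- choose the level `n` with small tail
  obtain ⟨n, hn⟩ : ∃ n : ℕ, ∑' p, (if n < wordLevel p then ‖c₀ p‖ else 0) < ‖a‖ / 2 := by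
    have hlim : Tendsto (fun n : ℕ => ∑' p, (if n < wordLevel p then ‖c₀ p‖ else 0)) atTop
        (𝓝 (∑' _ : List (Fin 2) × List (Fin 2), (0 : ℝ))) := by
      refine tendsto_tsum_of_dominated_convergence hc₀ (fun p => ?_)
        (Eventually.of_forall fun n p => ?_)
      · refine tendsto_const_nhds.congr' ?_
        filter_upwards [eventually_ge_atTop (wordLevel p)] with n hn
        rw [if_neg (by omega)]
      · split_ifs <;> simp
    rw [tsum_zero] at hlim
    exact (hlim.eventually (gt_mem_nhds (half_pos hpos))).exists
  obtain ⟨c, hc, ha, hlow, hhigh⟩ := h.exists_expansion_level_ge n hc₀ ha₀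
    (fun g hg => Summable.of_norm_bounded hg fun p => hbound _ p)
  -- split the mass
  set w : List (Fin 2) × List (Fin 2) → ℝ := fun p => if wordLevel p = n then ‖c p‖ else 0 with hw
  set v : List (Fin 2) × List (Fin 2) → ℝ := fun p => if n < wordLevel p then ‖c p‖ else 0 with hv
  have hws : Summable w := by
    refine Summable.of_nonneg_of_le (fun p => ?_) (fun p => ?_) hc <;>
      simp only [hw] <;> split_ifs <;> simp
  have hvs : Summable v := by
    refine Summable.of_nonneg_of_le (fun p => ?_) (fun p => ?_) hc <;>
      simp only [hv] <;> split_ifs <;> simp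
  have hv0 : ∀ p, 0 ≤ v p := fun p => by simp only [hv]; split_ifs <;> simp
  -- Raising the level may increase the ℓ¹ mass at or below level n, but coefficients above n are
  -- those of `c₀`, so the bound chosen beforehand still applies.
  have hvtail : ∑' p, v p < ‖a‖ / 2 := by
    convert hn using 3 with p
    simp only [hv]
    split_ifs with hp
    · rw [hhigh p hp]
    · rfl
  have hvw : ∀ p, ‖c p‖ = w p + v p := fun p => by
    simp only [hw, hv]
    rcases lt_trichotomy (wordLevel p) n with hp | hp | hp
    · rw [hlow p hp, if_neg (by omega), if_neg (by omega)]; simp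
    · rw [if_pos hp, if_neg (by omega), add_zero]
    · rw [if_neg (by omega), if_pos hp, zero_add]
  have hmass : ‖a‖ ≤ ∑' p, w p + ∑' p, v p := by
    rw [← hws.tsum_add hvs, ← ha.tsum_eq]
    refine tsum_of_norm_bounded (hws.add hvs).hasSum fun p => ?_
    rw [← hvw]; exact hbound _ p
  -- The layer mass is at least ‖a‖ minus the tail, hence more than ‖a‖/2 and more than the tail.
  obtain ⟨q, hq⟩ := exists_tsum_fiber_lt hvs hws (truncPair n) (by linarith)
  have hqn : wordLevel q = n := by
    by_contra hne
    have : w q = 0 := by simp only [hw]; rw [if_neg hne]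
    rw [this] at hq
    exact absurd hq (not_lt.2 (tsum_nonneg fun p => hv0 _))
  have hwq : w q = ‖c q‖ := by simp only [hw]; rw [if_pos hqn]
  -- the compressions
  set X : ℕ → B := fun m => listProd T (1 :: List.replicate m 0 ++ q.1) with hX
  set Y : ℕ → B := fun m => revProd S (1 :: List.replicate m 0 ++ q.2) with hY
  have hXY : ∀ m p, ‖X m * wordPair S T p * Y m‖ ≤ 1 := fun m p =>
    (norm_mul_le _ _).trans (mul_le_one₀ ((norm_mul_le _ _).trans
      (mul_le_one₀ (norm_listProd_le h1 hT _) (norm_nonneg _) (norm_wordPair_le h1 hS hT p)))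
      (norm_nonneg _) (norm_revProd_le h1 hS _))
  have hXYq : ∀ m, X m * wordPair S T q * Y m = 1 := fun m => h.compression_self q.1 q.2 _
  set D : List (Fin 2) × List (Fin 2) → Prop :=
    fun p => q.1.length + p.2.length = q.2.length + p.1.length with hD
  classical
  set off : ℕ → List (Fin 2) × List (Fin 2) → ℝ := fun m p =>
    if D p then 0 else ‖c p‖ * ‖X m * wordPair S T p * Y m‖ with hoff
  have hoff_le : ∀ m p, ‖off m p‖ ≤ ‖c p‖ := fun m p => by
    simp only [hoff]
    split_ifs
    · simp
    · rw [norm_mul, norm_norm, norm_norm]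
      exact mul_le_of_le_one_right (norm_nonneg _) (hXY m p)
  have hoffs : ∀ m, Summable (off m) := fun m => Summable.of_norm_bounded hc (hoff_le m)
  -- No single m kills all off-degree pairs, but each is killed for all large m, and |c_p|
  -- dominates.
  have hofflim : Tendsto (fun m => ∑' p, off m p) atTop (𝓝 0) := by
    have : Tendsto (fun m => ∑' p, off m p) atTop
        (𝓝 (∑' _ : List (Fin 2) × List (Fin 2), (0 : ℝ))) := by
      refine tendsto_tsum_of_dominated_convergence hc (fun p => ?_)
        (Eventually.of_forall fun m p => hoff_le m p)
      refine tendsto_const_nhds.congr' ?_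
      filter_upwards [eventually_ge_atTop
        (q.1.length + q.2.length + p.1.length + p.2.length)] with m hm
      simp only [hoff]
      split_ifs with hp
      · rfl
      · have : X m * wordPair S T p * Y m = 0 := h.compression_offDegree hp hm
        rw [this, norm_zero, mul_zero]
    rwa [tsum_zero] at this
  -- The pair q lies in its own fibre but contributes nothing here, as `v` vanishes on level n.
  set fib : List (Fin 2) × List (Fin 2) → ℝ := (truncPair n ⁻¹' {q}).indicator v with hfib
  have hfibs : Summable fib := hvs.indicator _
  have hfibsum : ∑' p, fib p < ‖c q‖ := by
    rw [hfib, ← tsum_subtype, ← hwq]; exact hq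
  obtain ⟨m, hm⟩ := (hofflim.eventually
    (gt_mem_nhds (sub_pos.2 hfibsum))).exists
  have hcompr : HasSum (fun p => c p • (X m * wordPair S T p * Y m)) (X m * a * Y m) := by
    have := (ha.mul_left (X m)).mul_right (Y m)
    simpa only [mul_smul_comm, smul_mul_assoc] using this
  have hest : ‖X m * a * Y m - c q • 1‖ ≤ ∑' p, (fib p + off m p) := by
    -- The term of q compresses exactly to c_q · 1, so subtracting it leaves the fibre above q and
    -- the off-degree pairs as the only errors.
    have hsub := hcompr.sub (hasSum_pi_single q (c q • (1 : B)) : HasSum _ _)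
    rw [← hsub.tsum_eq]
    refine tsum_of_norm_bounded (hfibs.add (hoffs m)).hasSum fun p => ?_
    have hfib0 : 0 ≤ fib p := Set.indicator_nonneg (fun p _ => hv0 p) p
    have hoff0 : 0 ≤ off m p := by simp only [hoff]; split_ifs <;> positivity
    by_cases hpq : p = q
    · subst hpq
      rw [Pi.single_eq_same, hXYq, sub_self, norm_zero]
      exact add_nonneg hfib0 hoff0
    rw [Pi.single_eq_of_ne hpq, sub_zero, norm_smul]
    by_cases hpD : D p
    · by_cases hpn : wordLevel p < n
      · rw [hlow p hpn, norm_zero, zero_mul]; exact add_nonneg hfib0 hoff0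
      by_cases htr : truncPair n p = q
      · have hpn' : n < wordLevel p := by
          refine lt_of_le_of_ne (not_lt.1 hpn) fun he => hpq ?_
          rw [← htr, truncPair, ← he]; simp
        have : fib p = ‖c p‖ := by
          rw [hfib, Set.indicator_of_mem (by simpa using htr)]
          simp only [hv]; rw [if_pos hpn']
        rw [this]
        have := mul_le_of_le_one_right (norm_nonneg (c p)) (hXY m p)
        linarith
      · have : X m * wordPair S T p * Y m = 0 :=
          h.compression_of_truncPair_ne hqn (not_lt.1 hpn) hpD htr _
        rw [this, norm_zero, mul_zero]; exact add_nonneg hfib0 hoff0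
    · have : off m p = ‖c p‖ * ‖X m * wordPair S T p * Y m‖ := by
        simp only [hoff]; rw [if_neg hpD]
      rw [this]; linarith
  rw [hfibs.tsum_add (hoffs m)] at hest
  have hlt : ‖X m * a * Y m - c q • 1‖ < ‖c q‖ := by linarith
  have hcq : c q ≠ 0 := by
    intro h0
    rw [h0, norm_zero] at hlt
    exact absurd hlt (not_lt.2 (norm_nonneg _))
  have hunit : ‖1 - (c q)⁻¹ • (X m * a * Y m)‖ < 1 := by
    have : 1 - (c q)⁻¹ • (X m * a * Y m) = -((c q)⁻¹ • (X m * a * Y m - c q • 1)) := by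
      rw [smul_sub, smul_smul, inv_mul_cancel₀ hcq, one_smul, neg_sub]
    rw [this, norm_neg, norm_smul, norm_inv, inv_mul_lt_iff₀ (norm_pos_iff.2 hcq), mul_one]
    exact hlt
  have hU : IsUnit ((c q)⁻¹ • (X m * a * Y m)) := by
    have := isUnit_one_sub_of_norm_lt_one hunit
    rwa [sub_sub_cancel] at this
  obtain ⟨u, hu⟩ := hU
  refine ⟨↑u⁻¹ * ((c q)⁻¹ • X m), Y m, ?_⟩
  rw [mul_assoc, mul_assoc, smul_mul_assoc, ← mul_assoc (X m), ← hu, Units.inv_mul]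

end IsCuntzFamily

/-! ### Normal form and universal property of `Cu2` -/

namespace Cu2

/-- Every nonzero element of `Cu₂` has the form `s_u s_v*`. -/
theorem eq_zero_or_eq_wordPair (a : Cu2) : a = 0 ∨ ∃ p, a = wordPair s sStar p := by
  obtain ⟨w, rfl⟩ := mk_surjective a
  induction w using WithZero.recZeroCoe with
  | zero => exact Or.inl rfl
  | coe w =>
    induction w using FreeMonoid.inductionOn' with
    | one =>
      refine Or.inr ⟨([], []), ?_⟩
      change mk 1 = _
      simp [wordPair, revProd, listProd]
    | of_mul x w ih =>
      rw [WithZero.coe_mul, map_mul]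
      rcases ih with ih | ⟨⟨u, v⟩, ih⟩
      · left; rw [ih, mul_zero]
      rw [ih]
      cases x with
      | s i =>
        refine Or.inr ⟨(u ++ [i], v), ?_⟩
        change s i * _ = _
        simp [wordPair, revProd_append, revProd, mul_assoc]
      | sStar i =>
        change sStar i * _ = 0 ∨ ∃ p, sStar i * _ = _
        -- Because of the reversed order, the leftmost factor of s_u is the last entry of u; only
        -- that letter meets s_i*.
        rcases List.eq_nil_or_concat u with rfl | ⟨u, j, rfl⟩
        · exact Or.inr ⟨([], i :: v), by simp [wordPair, revProd, listProd]⟩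
        · have : sStar i * wordPair s sStar (u ++ [j], v) =
              (sStar i * s j) * wordPair s sStar (u, v) := by
            simp [wordPair, revProd_append, revProd, mul_assoc]
          rw [List.concat_eq_append, this]
          by_cases hij : i = j
          · subst hij
            exact Or.inr ⟨(u, v), by rw [sStar_mul_s_same, one_mul]⟩
          · left; rw [sStar_mul_s_diff _ _ hij, zero_mul]

/-- The homomorphism on words given by the images of the generators. -/
def wordHom {M : Type*} [MonoidWithZero M] (V U : Fin 2 → M) : CuntzWord →*₀ M :=
  WithZero.lift' (FreeMonoid.lift fun
    | CuntzGen.s i => V i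
    | CuntzGen.sStar i => U i)

theorem wordHom_s {M : Type*} [MonoidWithZero M] (V U : Fin 2 → M) (i : Fin 2) :
    wordHom V U (CuntzGen.s i).word = V i := by
  simp [wordHom, CuntzGen.word]

theorem wordHom_sStar {M : Type*} [MonoidWithZero M] (V U : Fin 2 → M) (i : Fin 2) :
    wordHom V U (CuntzGen.sStar i).word = U i := by
  simp [wordHom, CuntzGen.word]

/-- The homomorphism out of `Cu₂` determined by elements satisfying its defining relations. -/
def liftHom {M : Type*} [MonoidWithZero M] (V U : Fin 2 → M) (hself : ∀ i, U i * V i = 1)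
    (hne : ∀ i j, i ≠ j → U i * V j = 0) : Cu2 →* M :=
  (conGen CuntzRel).lift (wordHom V U : CuntzWord →* M) (by
    refine Con.conGen_le.2 fun x y hxy => ?_
    rw [Con.ker_rel]
    change wordHom V U x = wordHom V U y
    cases hxy with
    | same i => rw [map_mul, map_one, wordHom_s, wordHom_sStar, hself]
    | diff i j hij => rw [map_mul, map_zero, wordHom_s, wordHom_sStar, hne i j hij])

section liftHom

variable {M : Type*} [MonoidWithZero M] (V U : Fin 2 → M) (hself : ∀ i, U i * V i = 1)
    (hne : ∀ i j, i ≠ j → U i * V j = 0)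

theorem liftHom_s (i : Fin 2) : liftHom V U hself hne (s i) = V i :=
  wordHom_s V U i

theorem liftHom_sStar (i : Fin 2) : liftHom V U hself hne (sStar i) = U i :=
  wordHom_sStar V U i

theorem liftHom_zero : liftHom V U hself hne 0 = 0 :=
  map_zero (wordHom V U)

end liftHom

end Cu2

/-! ### A Cuntz family on bounded sequences -/

section Representation

open BoundedContinuousFunction

/-- The operator `ξ ↦ ξ(2 · + i)` on bounded sequences. -/
noncomputable def seqSelect (i : Fin 2) : (ℕ →ᵇ ℂ) →L[ℂ] (ℕ →ᵇ ℂ) :=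
  compContinuousCLM ℂ ℂ ⟨fun n => 2 * n + i.val, continuous_of_discreteTopology⟩

theorem seqSelect_apply (i : Fin 2) (ξ : ℕ →ᵇ ℂ) (n : ℕ) :
    seqSelect i ξ n = ξ (2 * n + i.val) := rfl

theorem norm_seqSelect_le (i : Fin 2) : ‖seqSelect i‖ ≤ 1 := by
  refine ContinuousLinearMap.opNorm_le_bound _ zero_le_one fun ξ => ?_
  rw [one_mul]
  exact norm_compContinuous_le ξ _

theorem norm_spread_le (i : Fin 2) (ξ : ℕ →ᵇ ℂ) (n : ℕ) :
    ‖if n % 2 = i.val then ξ (n / 2) else 0‖ ≤ ‖ξ‖ := by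
  split_ifs
  · exact ξ.norm_coe_le_norm _
  · simp

/-- The sequence which equals `ξ` on the residue class of `i` modulo `2` and vanishes elsewhere. -/
noncomputable def spread (i : Fin 2) (ξ : ℕ →ᵇ ℂ) : ℕ →ᵇ ℂ :=
  ofNormedAddCommGroupDiscrete (fun n : ℕ => if n % 2 = i.val then ξ (n / 2) else 0) ‖ξ‖
    (norm_spread_le i ξ)

theorem spread_apply (i : Fin 2) (ξ : ℕ →ᵇ ℂ) (n : ℕ) :
    spread i ξ n = if n % 2 = i.val then ξ (n / 2) else 0 := rfl

/-- The operator which places a bounded sequence on the residue class of `i` modulo `2`. -/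
noncomputable def seqSpread (i : Fin 2) : (ℕ →ᵇ ℂ) →L[ℂ] (ℕ →ᵇ ℂ) :=
  LinearMap.mkContinuous
    { toFun := spread i
      map_add' := fun ξ η => by
        ext n
        rw [BoundedContinuousFunction.add_apply]
        simp only [spread_apply, BoundedContinuousFunction.add_apply]
        split_ifs <;> simp
      map_smul' := fun z ξ => by
        ext n
        rw [RingHom.id_apply, BoundedContinuousFunction.smul_apply]
        simp only [spread_apply, BoundedContinuousFunction.smul_apply]
        split_ifs <;> simp } 1
    (fun ξ => by
      rw [one_mul]
      exact (norm_le (norm_nonneg _)).2 (norm_spread_le i ξ))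

theorem seqSpread_apply (i : Fin 2) (ξ : ℕ →ᵇ ℂ) (n : ℕ) :
    seqSpread i ξ n = if n % 2 = i.val then ξ (n / 2) else 0 := rfl

theorem norm_seqSpread_le (i : Fin 2) : ‖seqSpread i‖ ≤ 1 := by
  refine ContinuousLinearMap.opNorm_le_bound _ zero_le_one fun ξ => ?_
  rw [one_mul]
  exact (norm_le (norm_nonneg _)).2 (norm_spread_le i ξ)

/-- Each natural number is 2k + i for exactly one k and one i in {0, 1}, so the two operators split
a sequence into its even and odd parts and reassemble it. -/
theorem isCuntzFamily_seq : IsCuntzFamily seqSpread seqSelect where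
  mul_self i := by
    ext ξ n
    have h1 : (2 * n + i.val) % 2 = i.val := by omega
    have h2 : (2 * n + i.val) / 2 = n := by omega
    change seqSelect i (seqSpread i ξ) n = ξ n
    rw [seqSelect_apply, seqSpread_apply, if_pos h1, h2]
  mul_of_ne i j hij := by
    ext ξ n
    have h1 : ¬ (2 * n + i.val) % 2 = j.val := fun h => hij (Fin.ext (by omega))
    change seqSelect i (seqSpread j ξ) n = 0
    rw [seqSelect_apply, seqSpread_apply, if_neg h1]
  sum_eq := by
    ext ξ n
    rw [Fin.sum_univ_two]
    change seqSpread 0 (seqSelect 0 ξ) n + seqSpread 1 (seqSelect 1 ξ) n = ξ n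
    rw [seqSpread_apply, seqSpread_apply, seqSelect_apply, seqSelect_apply]
    rcases Nat.mod_two_eq_zero_or_one n with h | h
    · rw [if_pos (by simpa using h), if_neg (by simp [h]), add_zero]
      congr 1; simp; omega
    · rw [if_neg (by simp [h]), if_pos (by simpa using h), zero_add]
      congr 1; simp; omega

end Representation

/-! ### Extending representations to ℓ¹ and properness of the ideal -/

namespace ReducedL1

variable {S : Type*} [MonoidWithZero S] {E : Type*} [NormedRing E] [NormedAlgebra ℂ E]
  [CompleteSpace E]

/-- A bounded zero-preserving homomorphism extends to a multiplicative map on `ℓ¹`. -/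
theorem lift_mul (φ : S →* E) (h0 : φ 0 = 0) (C : ℝ) (hφ : ∀ s : {s : S // s ≠ 0}, ‖φ s.1‖ ≤ C)
    (f g : ReducedL1 S) :
    lift (fun s => φ s.1) C hφ (f * g) =
      lift (fun s => φ s.1) C hφ f * lift (fun s => φ s.1) C hφ g := by
  have hd : ∀ s : S, lift (fun s => φ s.1) C hφ (delta s) = φ s := fun s => by
    by_cases hs : s = 0
    · rw [hs, delta_zero, map_zero, h0]
    · exact lift_delta _ C hφ ⟨s, hs⟩
  revert f
  refine induction_delta ?_ ?_ ?_ ?_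
  · exact isClosed_eq ((lift _ C hφ).continuous.comp (cont_mul_left g))
      ((lift _ C hφ).continuous.mul continuous_const)
  · simp
  · intro f₁ f₂ h₁ h₂; simp only [add_mul, map_add, h₁, h₂]
  intro c s
  simp only [smul_mul_assoc, map_smul]
  congr 1
  revert g
  refine induction_delta ?_ ?_ ?_ ?_
  · exact isClosed_eq ((lift _ C hφ).continuous.comp (cont_mul_right _))
      (continuous_const.mul (lift _ C hφ).continuous)
  · simp
  · intro f₁ f₂ h₁ h₂; simp only [mul_add, map_add, h₁, h₂]
  intro d t
  simp only [mul_smul_comm, map_smul, delta_mul_delta, hd, map_mul]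

end ReducedL1

namespace CuntzL1

/-- The family extends to a continuous homomorphism on ℓ¹ whose kernel is a closed two-sided ideal
containing f₀ but not 1. -/
theorem one_notMem_J_of_isCuntzFamily {E : Type*} [NormedRing E] [NormedAlgebra ℂ E]
    [CompleteSpace E] [Nontrivial E] {V U : Fin 2 → E} (hVU : IsCuntzFamily V U)
    (h1 : ‖(1 : E)‖ ≤ 1) (hV : ∀ i, ‖V i‖ ≤ 1) (hU : ∀ i, ‖U i‖ ≤ 1) :
    (1 : CuntzL1) ∉ J := by
  set φ := Cu2.liftHom V U hVU.mul_self hVU.mul_of_ne with hφ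
  have hφs : ∀ i, φ (Cu2.s i) = V i := Cu2.liftHom_s V U _ _
  have hφt : ∀ i, φ (Cu2.sStar i) = U i := Cu2.liftHom_sStar V U _ _
  have hφ0 : φ 0 = 0 := Cu2.liftHom_zero V U _ _
  have hb : ∀ a : {a : Cu2 // a ≠ 0}, ‖φ a.1‖ ≤ 1 := by
    rintro ⟨a, ha⟩
    -- The normal form gives the uniform bound 1 on the images of nonzero elements, which the
    -- extension to ℓ¹ requires.
    rcases Cu2.eq_zero_or_eq_wordPair a with h | ⟨p, rfl⟩
    · exact absurd h ha
    · have : φ (wordPair Cu2.s Cu2.sStar p) = wordPair V U p := by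
        rw [wordPair, map_mul, map_revProd, map_listProd]
        simp only [hφs, hφt]; rfl
      simp only [this]
      exact norm_wordPair_le h1 hV hU p
  set L := ReducedL1.lift (fun a : {a : Cu2 // a ≠ 0} => φ a.1) 1 hb with hL
  have hmul : ∀ f g, L (f * g) = L f * L g := ReducedL1.lift_mul φ hφ0 1 hb
  have hd : ∀ a : Cu2, L (ReducedL1.delta a) = φ a := fun a => by
    by_cases ha : a = 0
    · rw [ha, ReducedL1.delta_zero, map_zero, hφ0]
    · exact ReducedL1.lift_delta _ 1 hb ⟨a, ha⟩
  let I : Ideal CuntzL1 :=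
    { carrier := {f | L f = 0}
      add_mem' := fun {a b} ha hb => by
        simp only [Set.mem_ofPred_eq] at *; rw [map_add, ha, hb, add_zero]
      zero_mem' := map_zero L
      smul_mem' := fun c x hx => by
        simp only [Set.mem_ofPred_eq, smul_eq_mul] at *; rw [hmul, hx, mul_zero] }
  intro hJ
  have hI : (1 : CuntzL1) ∈ I := by
    refine mem_J.1 hJ I ⟨fun {a} b ha => ?_⟩ ?_ ?_
    · change L (a * b) = 0
      rw [hmul, show L a = 0 from ha, zero_mul]
    · exact isClosed_eq L.continuous continuous_const
    · change L f₀ = 0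
      rw [f₀, map_sub, map_sub, hd, hd, hd, map_one, map_mul, map_mul, Cu2.star_s, Cu2.star_s,
        hφs, hφs, hφt, hφt, ← hVU.sum_eq, Fin.sum_univ_two]
      abel
  have h2 : L 1 = 0 := hI
  rw [ReducedL1.one_def, hd, map_one] at h2
  exact one_ne_zero h2

theorem one_notMem_J : (1 : CuntzL1) ∉ J := by
  have : Nontrivial (BoundedContinuousFunction ℕ ℂ) :=
    ⟨BoundedContinuousFunction.const ℕ 1, 0, fun h => one_ne_zero (DFunLike.congr_fun h 0)⟩
  have : Nontrivial (BoundedContinuousFunction ℕ ℂ →L[ℂ] BoundedContinuousFunction ℕ ℂ) :=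
    ⟨1, 0, fun h => by
      obtain ⟨ξ, hξ⟩ := exists_ne (0 : BoundedContinuousFunction ℕ ℂ)
      exact hξ (DFunLike.congr_fun h ξ)⟩
  exact one_notMem_J_of_isCuntzFamily
    (E := BoundedContinuousFunction ℕ ℂ →L[ℂ] BoundedContinuousFunction ℕ ℂ) isCuntzFamily_seq
    ContinuousLinearMap.norm_id_le norm_seqSpread_le norm_seqSelect_le

end CuntzL1

/-! ### The quotient algebra -/

namespace CuntzQuotient

noncomputable section

/-- The image of `δ_a` in the quotient. -/
def point (a : Cu2) : CuntzQuotient := Ideal.Quotient.mk CuntzL1.J (ReducedL1.delta a)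

theorem point_mul (a b : Cu2) : point (a * b) = point a * point b := by
  rw [point, ← ReducedL1.delta_mul_delta, map_mul]; rfl

theorem point_one : point 1 = 1 := rfl

theorem point_zero : point 0 = 0 := by rw [point, ReducedL1.delta_zero, map_zero]

theorem norm_mk_le (f : CuntzL1) : ‖Ideal.Quotient.mk CuntzL1.J f‖ ≤ ‖f‖ :=
  Submodule.Quotient.norm_mk_le (S := CuntzL1.J) f

theorem norm_point_le (a : Cu2) : ‖point a‖ ≤ 1 :=
  (norm_mk_le _).trans (ReducedL1.norm_delta_le a)

/-- `point` as a monoid homomorphism. -/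
def pointHom : Cu2 →* CuntzQuotient where
  toFun := point
  map_one' := point_one
  map_mul' := point_mul

theorem isCuntzFamily :
    IsCuntzFamily (fun i => point (Cu2.s i)) (fun i => point (Cu2.sStar i)) where
  mul_self i := by rw [← point_mul, Cu2.sStar_mul_s_same, point_one]
  mul_of_ne i j hij := by rw [← point_mul, Cu2.sStar_mul_s_diff i j hij, point_zero]
  sum_eq := by
    have hf : Ideal.Quotient.mk CuntzL1.J CuntzL1.f₀ = 0 :=
      Ideal.Quotient.eq_zero_iff_mem.2 (CuntzL1.mem_J.2 fun _ _ _ h => h)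
    rw [CuntzL1.f₀, map_sub, map_sub, Cu2.star_s, Cu2.star_s] at hf
    change point 1 - point (Cu2.s 0 * Cu2.sStar 0) - point (Cu2.s 1 * Cu2.sStar 1) = 0 at hf
    rw [Fin.sum_univ_two, ← point_mul, ← point_mul, ← point_one]
    rw [sub_sub, sub_eq_zero] at hf
    exact hf.symm

instance : CompleteSpace CuntzQuotient :=
  inferInstanceAs (CompleteSpace (CuntzL1 ⧸ CuntzL1.J))

theorem exists_expansion (x : CuntzQuotient) : ∃ c : List (Fin 2) × List (Fin 2) → ℂ,
    (Summable fun p => ‖c p‖) ∧ HasSum (fun p => c p •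
      wordPair (fun i => point (Cu2.s i)) (fun i => point (Cu2.sStar i)) p) x := by
  obtain ⟨f, rfl⟩ := Ideal.Quotient.mk_surjective x
  have hex : ∀ a : {a : Cu2 // a ≠ 0}, ∃ p, a.1 = wordPair Cu2.s Cu2.sStar p := fun a =>
    (Cu2.eq_zero_or_eq_wordPair a.1).resolve_left a.2
  choose φ hφ using hex
  -- Uniqueness of the normal form is not needed: any chosen pair determines its element, so the
  -- choice is injective and the coefficients can be extended by zero.
  have hinj : Function.Injective φ := fun a b hab => Subtype.ext (by rw [hφ a, hφ b, hab])
  have hpt : ∀ a, point a.1 =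
      wordPair (fun i => point (Cu2.s i)) (fun i => point (Cu2.sStar i)) (φ a) := fun a => by
    conv_lhs => rw [hφ a]
    change pointHom _ = _
    rw [wordPair, map_mul, map_revProd, map_listProd]
    rfl
  refine ⟨Function.extend φ f.coeff 0, ?_, ?_⟩
  · rw [comp_extend_zero hinj f.coeff (fun z _ => ‖z‖) (fun _ => norm_zero),
      summable_extend_zero hinj]
    exact f.hasSum_norm_coeff.summable
  · rw [comp_extend_zero hinj f.coeff (fun z p => z • wordPair (fun i => point (Cu2.s i))
      (fun i => point (Cu2.sStar i)) p) (fun _ => zero_smul _ _), hasSum_extend_zero hinj]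
    have hcont : Continuous (Ideal.Quotient.mk CuntzL1.J) :=
      AddMonoidHomClass.continuous_of_bound (Ideal.Quotient.mk CuntzL1.J) 1 fun f => by
        rw [one_mul]; exact norm_mk_le f
    have := (ReducedL1.hasSum_delta f).map (Ideal.Quotient.mk CuntzL1.J) hcont
    refine this.congr_fun fun a => ?_
    rw [← hpt]
    rfl

instance : Nontrivial CuntzQuotient :=
  ⟨1, 0, fun h => CuntzL1.one_notMem_J (Ideal.Quotient.eq_zero_iff_mem.1 h)⟩

theorem not_isUnit_point_s : ¬ IsUnit (point (Cu2.s 0)) := by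
  intro hu
  have h1 := isCuntzFamily.mul_of_ne 1 0 (by decide)
  have h2 : point (Cu2.sStar 1) = 0 := hu.mul_left_eq_zero.1 h1
  have h3 := isCuntzFamily.mul_self 1
  simp only [h2, zero_mul] at h3
  exact zero_ne_one h3

/-- Left multiplication by S_0 is injective because T_0 S_0 = 1. In finite dimension it would be
surjective, giving S_0 a right inverse as well and making it a unit. -/
theorem not_finiteDimensional : ¬ FiniteDimensional ℂ CuntzQuotient := by
  intro hfin
  have hinj : Function.Injective (LinearMap.mulLeft ℂ (point (Cu2.s 0))) := by
    intro x y hxy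
    have h1 := isCuntzFamily.mul_self 0
    simp only [LinearMap.mulLeft_apply] at hxy h1
    rw [← one_mul x, ← one_mul y, ← h1, mul_assoc, hxy, mul_assoc]
  obtain ⟨y, hy⟩ := LinearMap.injective_iff_surjective.1 hinj 1
  exact not_isUnit_point_s (isUnit_iff_exists_and_exists.2
    ⟨⟨y, hy⟩, ⟨_, isCuntzFamily.mul_self 0⟩⟩)

theorem norm_star_le (x : CuntzQuotient) : ‖star x‖ ≤ ‖x‖ := by
  refine le_of_forall_pos_le_add fun ε hε => ?_
  obtain ⟨f, rfl, hf⟩ := Submodule.Quotient.norm_mk_lt x hε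
  change ‖Ideal.Quotient.mk CuntzL1.J (star f)‖ ≤ _
  refine (norm_mk_le _).trans ?_
  rw [norm_star]
  exact hf.le

theorem star_star_eq (x : CuntzQuotient) : star (star x) = x := by
  obtain ⟨f, rfl⟩ := Ideal.Quotient.mk_surjective x
  rw [star_mk, star_mk, star_star]

theorem isBanachStarAlgebra : IsBanachStarAlgebra CuntzQuotient where
  complete := inferInstance
  norm_one := by
    refine le_antisymm (norm_point_le 1) ?_
    have h1 : (0 : ℝ) < ‖(1 : CuntzQuotient)‖ := norm_pos_iff.2 one_ne_zero
    have h2 := norm_mul_le (1 : CuntzQuotient) 1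
    rw [one_mul] at h2
    -- From ‖1‖ ≤ ‖1‖² and ‖1‖ > 0 it follows that ‖1‖ ≥ 1.
    nlinarith
  star_star := star_star_eq
  star_add x y := by
    obtain ⟨f, rfl⟩ := Ideal.Quotient.mk_surjective x
    obtain ⟨g, rfl⟩ := Ideal.Quotient.mk_surjective y
    rw [← map_add, star_mk, star_mk, star_mk, star_add, map_add]
  star_smul c x := by
    obtain ⟨f, rfl⟩ := Ideal.Quotient.mk_surjective x
    change Ideal.Quotient.mk CuntzL1.J (star (c • f)) = _
    rw [star_smul]
    rfl
  star_mul x y := by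
    obtain ⟨f, rfl⟩ := Ideal.Quotient.mk_surjective x
    obtain ⟨g, rfl⟩ := Ideal.Quotient.mk_surjective y
    rw [← map_mul, star_mk, star_mk, star_mk, star_mul, map_mul]
  norm_star x := by
    refine le_antisymm (norm_star_le x) ?_
    have := norm_star_le (star x)
    rwa [star_star_eq] at this

theorem isPurelyInfinite : IsPurelyInfinite CuntzQuotient where
  not_division hdiv := by
    refine not_isUnit_point_s (hdiv _ fun h => ?_)
    have h1 := isCuntzFamily.mul_self 0
    simp only [h, mul_zero] at h1
    exact zero_ne_one h1
  factor a ha := by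
    obtain ⟨c, hc, hsum⟩ := exists_expansion a
    exact isCuntzFamily.exists_mul_mul_eq_one (norm_point_le 1) (fun _ => norm_point_le _)
      (fun _ => norm_point_le _) ha hc hsum

end

end CuntzQuotient

theorem theorem3p14 :
    IsBanachStarAlgebra CuntzQuotient ∧
      ¬ FiniteDimensional ℂ CuntzQuotient ∧
      IsPurelyInfinite CuntzQuotient :=
  ⟨CuntzQuotient.isBanachStarAlgebra, CuntzQuotient.not_finiteDimensional,
    CuntzQuotient.isPurelyInfinite⟩
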